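/- Let $\mathcal H$ be a complex Hilbert space, $\mathcal B(\mathcal H)$ the algebra of bounded linear operators on $\mathcal H$ with the operator norm, $Y$ a complex Banach space, $1\le p<\infty$, $\lambda>1$ and $n\ge 1$. Let $U:\mathcal B(\mathcal H)\to Y$ be a non-zero bounded linear operator with $\|U\|<\lambda$, and let $\Omega\subset\mathbb C^n$ be a bounded simply connected complete Reinhardt domain, i.e. a non-empty connected open set such that $z\in\Omega$ and $|w_i|\le|z_i|$ for all $i$ imply $w\in\Omega$. Every bounded pluriharmonic $f:\Omega\to\mathcal B(\mathcal H)$ has the form $$f(z)=\sum_{m=0}^{\infty}\sum_{|\alpha|=m}a_\alpha z^\alpha+\sum_{m=1}^{\infty}\sum_{|\alpha|=m}b_\alpha^{*}\,\bar z^{\alpha}\qquad(z\in\Omega),\tag{1}$$ where $a_\alpha,b_\alpha\in\mathcal B(\mathcal H)$ and $\sum_{m\ge0}\sum_{|\alpha|=m}a_\alpha z^\alpha$, $\sum_{m\ge1}\sum_{|\alpha|=m}b_\alpha z^\alpha$ are holomorphic on $\Omega$; put $b_0=0$ and $\|f\|_\Omega=\sup_{z\in\Omega}\|f(z)\|$.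 The second $\lambda$-powered Bohr radius $L_\lambda(\Omega,p,U)$ is the supremum of all $r\in[0,1]$ such that for all bounded pluriharmonic $f:\Omega\to\mathcal B(\mathcal H)$ of the form (1) $$\sum_{m=0}^{\infty}\sum_{|\alpha|=m}\ \sup_{z\in r\Omega}\big(\|U(a_\alpha)\|^p+\|U(b_\alpha)\|^p\big)|z^\alpha|^p\le\lambda^p\,\|f\|_\Omega^p .$$ For bounded $\Omega_1,\Omega_2\subset\mathbb C^n$ let $S(\Omega_1,\Omega_2)=\inf\{s>0:\Omega_1\subset s\,\Omega_2\}$, and let $\mathbb D^n$ be the open unit polydisc. Then $$L_\lambda(\Omega,p,U)\ \ge\ D\cdot\frac1{n^{1/p}}\cdot\frac{1}{S(\Omega,\mathbb D^n)\,S(\mathbb D^n,\Omega)},$$ where, with $\kappa=\dfrac{1}{4\lambda\,2^{1/p}}$, $$D=\begin{cases}\max\left\{\kappa\left(\dfrac{\lambda^p-\|U\|^p}{2\lambda^p-\|U\|}\right)^{1/p},\ \kappa\left(\dfrac{\lambda^p-\|U\|^p}{\lambda^p-\|U\|^p+1}\right)^{1/p}\dfrac1{\|U\|}\right\}&\text{if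 }\|U\|\ge\kappa,\\[3mm]\max\left\{\kappa\left(\dfrac{\lambda^p-\|U\|^p}{2\lambda^p-\|U\|}\right)^{1/p},\ \kappa\left(\dfrac{\lambda^p-\|U\|^p}{\lambda^p-\|U\|^p+1}\right)^{1/p}\right\}&\text{if }0<\|U\|<\kappa.\end{cases}$$ In particular $L_\lambda(\Omega,p,U)>0$. -/

import Mathlib

open scoped Pointwise ENNReal

noncomputable section

namespace SecondBohr

/-- A complete Reinhardt domain in `ℂⁿ`: a nonempty connected open set which with a point `z`
contains every `w` satisfying `|wᵢ| ≤ |zᵢ|` for all `i`. -/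
structure IsCompleteReinhardtDomain {n : ℕ} (Ω : Set (Fin n → ℂ)) : Prop where
  isOpen : IsOpen Ω
  isConnected : IsConnected Ω
  complete : ∀ z ∈ Ω, ∀ w : Fin n → ℂ, (∀ i, ‖w i‖ ≤ ‖z i‖) → w ∈ Ω

/-- The open unit polydisc `𝔻ⁿ`. -/
def polydisc (n : ℕ) : Set (Fin n → ℂ) := {z | ∀ i, ‖z i‖ < 1}

/-- `S(Ω₁, Ω₂) = inf {s > 0 : Ω₁ ⊆ s Ω₂}`. -/
def inclusionScale {n : ℕ} (Ω₁ Ω₂ : Set (Fin n → ℂ)) : ℝ :=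
  sInf {s : ℝ | 0 < s ∧ Ω₁ ⊆ s • Ω₂}

/-- The multi-indices `α ∈ ℕⁿ` of degree `|α| = m`. -/
def multiIndices (n m : ℕ) : Finset (Fin n → ℕ) :=
  Finset.piAntidiag Finset.univ m

/-- The monomial `z ^ α`. -/
def monomial {n : ℕ} (α : Fin n → ℕ) (z : Fin n → ℂ) : ℂ :=
  ∏ i, z i ^ α i

section Functions

variable {n : ℕ} {X : Type*} [NormedAddCommGroup X] [NormedSpace ℂ X]

/-- A function is pluriharmonic on `Ω` if it is continuous there and its restriction to every
complex line is harmonic. -/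
def IsPluriharmonicOn (f : (Fin n → ℂ) → X) (Ω : Set (Fin n → ℂ)) : Prop :=
  ContinuousOn f Ω ∧ ∀ z ∈ Ω, ∀ v : Fin n → ℂ,
    InnerProductSpace.HarmonicAt (fun ζ : ℂ => f (z + ζ • v)) 0

/-- The bounded pluriharmonic functions on `Ω`. -/
def IsBoundedPluriharmonicOn (f : (Fin n → ℂ) → X) (Ω : Set (Fin n → ℂ)) : Prop :=
  IsPluriharmonicOn f Ω ∧ ∃ C : ℝ, ∀ z ∈ Ω, ‖f z‖ ≤ C

/-- `‖f‖_Ω = sup_{z ∈ Ω} ‖f z‖`; it is used for nonempty `Ω` and `f` bounded on `Ω`. -/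
def supNorm (f : (Fin n → ℂ) → X) (Ω : Set (Fin n → ℂ)) : ℝ :=
  ⨆ z : Ω, ‖f z‖

/-- `h` is holomorphic on `Ω` with the expansion
`h z = ∑_{m ≥ 0} ∑_{|α| = m} c_α z^α` for all `z ∈ Ω`. -/
def HasHolomorphicExpansionOn (h : (Fin n → ℂ) → X) (c : (Fin n → ℕ) → X)
    (Ω : Set (Fin n → ℂ)) : Prop :=
  DifferentiableOn ℂ h Ω ∧
    ∀ z ∈ Ω, HasSum (fun m : ℕ => ∑ α ∈ multiIndices n m, monomial α z • c α) (h z)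

end Functions

section Operators

variable {n : ℕ} {H : Type*} [NormedAddCommGroup H] [InnerProductSpace ℂ H] [CompleteSpace H]
  {Y : Type*} [NormedAddCommGroup Y] [NormedSpace ℂ Y]

/-- On `Ω` the function `f` has the form
`f z = ∑_{m ≥ 0} ∑_{|α| = m} a_α z^α + ∑_{m ≥ 1} ∑_{|α| = m} b_α^* conj(z)^α`, that is,
`f = h + g^*` where `h = ∑ a_α z^α` and `g = ∑_{m ≥ 1} b_α z^α` are holomorphic on `Ω`.
The second series has no constant term, which is expressed by `b 0 = 0`. -/
def HasPluriharmonicExpansionOn (f : (Fin n → ℂ) → (H →L[ℂ] H))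
    (a b : (Fin n → ℕ) → (H →L[ℂ] H)) (Ω : Set (Fin n → ℂ)) : Prop :=
  b 0 = 0 ∧ ∃ h g : (Fin n → ℂ) → (H →L[ℂ] H),
    HasHolomorphicExpansionOn h a Ω ∧ HasHolomorphicExpansionOn g b Ω ∧
      ∀ z ∈ Ω, f z = h z + ContinuousLinearMap.adjoint (g z)

/-- `∑_{m ≥ 0} ∑_{|α| = m} sup_{z ∈ rΩ} (‖U a_α‖^p + ‖U b_α‖^p) |z^α|^p`, a sum of nonnegative
terms taken in `[0, ∞]`. -/
def bohrSum (Ω : Set (Fin n → ℂ)) (p : ℝ) (U : (H →L[ℂ] H) →L[ℂ] Y)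
    (a b : (Fin n → ℕ) → (H →L[ℂ] H)) (r : ℝ) : ℝ≥0∞ :=
  ∑' m : ℕ, ∑ α ∈ multiIndices n m, ⨆ z ∈ r • Ω,
    ENNReal.ofReal ((‖U (a α)‖ ^ p + ‖U (b α)‖ ^ p) * ‖monomial α z‖ ^ p)

/-- The second `lam`-powered Bohr radius `L_lam(Ω, p, U)` of `U` with respect to the bounded
pluriharmonic functions on `Ω` with values in `B(H)`. -/
def secondBohrRadius (lam : ℝ) (Ω : Set (Fin n → ℂ)) (p : ℝ) (U : (H →L[ℂ] H) →L[ℂ] Y) : ℝ :=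
  sSup {r : ℝ | r ∈ Set.Icc (0 : ℝ) 1 ∧
    ∀ f : (Fin n → ℂ) → (H →L[ℂ] H), IsBoundedPluriharmonicOn f Ω →
      ∀ a b : (Fin n → ℕ) → (H →L[ℂ] H), HasPluriharmonicExpansionOn f a b Ω →
        bohrSum Ω p U a b r ≤ ENNReal.ofReal (lam ^ p * supNorm f Ω ^ p)}

end Operators

/-- The explicit constant `D`, as a function of `lam`, `p` and `u = ‖U‖`. -/
def boundConst (lam p u : ℝ) : ℝ :=
  if 1 / (4 * lam * 2 ^ (1 / p)) ≤ u then
    max (1 / (4 * lam * 2 ^ (1 / p)) * ((lam ^ p - u ^ p) / (2 * lam ^ p - u)) ^ (1 / p))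
      (1 / (4 * lam * 2 ^ (1 / p)) *
        ((lam ^ p - u ^ p) / (lam ^ p - u ^ p + 1)) ^ (1 / p) * (1 / u))
  else
    max (1 / (4 * lam * 2 ^ (1 / p)) * ((lam ^ p - u ^ p) / (2 * lam ^ p - u)) ^ (1 / p))
      (1 / (4 * lam * 2 ^ (1 / p)) *
        ((lam ^ p - u ^ p) / (lam ^ p - u ^ p + 1)) ^ (1 / p))

end SecondBohr

end

/-! Cauchy estimates hold on Ω itself: if ‖f‖ ≤ M there, then ‖z^α‖‖a_α‖ ≤ M and ‖z^α‖‖b_α‖ ≤ M for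
every z ∈ Ω. They come from Fourier coefficients, first along ζ ↦ f(ζz) to isolate a homogeneous
part (holomorphic and conjugate parts have opposite frequencies), then in each coordinate to isolate
a monomial.

Write u = ‖U‖ and x = n r^p. There are at most n^m multi-indices of degree m, so the degree-m part
of the Bohr sum at radius r is at most 2u^p M^p x^m, and u^p M^p for m = 0 because b_0 = 0. The
geometric series gives u^p M^p (1+x)/(1-x), which is at most lam^p M^p exactly when x ≤ (lam^p -
u^p)/(lam^p + u^p); this is `le_secondBohrRadius`.

It remains to see that D^p lies below this threshold, so that r = D/n^(1/p) is admissible, and that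
the factor 1/(S·S) is at most 1 and only weakens the bound. -/

namespace SecondBohr

open Finset Filter Topology

/-! ### Fourier coefficients of trigonometric polynomials -/

section Averages

variable {X : Type*} [NormedAddCommGroup X] [NormedSpace ℂ X] [CompleteSpace X]

lemma circleIntegral_zpow_sub_one (k : ℤ) :
    (∮ ζ in C(0, 1), ζ ^ (k - 1)) = if k = 0 then 2 * Real.pi * Complex.I else 0 := by
  split_ifs with h
  · subst h
    simpa using circleIntegral.integral_sub_center_inv (0 : ℂ) (R := 1) one_ne_zero
  · simpa using circleIntegral.integral_sub_zpow_of_ne (n := k - 1) (by omega) 0 0 1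

/-- A Fourier coefficient of a trigonometric polynomial is bounded by its supremum. -/
lemma norm_sum_filter_le_of_trigPolynomial {ι : Type*} (s : Finset ι) (κ : ι → ℤ) (c : ι → X)
    (m : ℤ) {M : ℝ} (hM : ∀ ζ : ℂ, ‖ζ‖ = 1 → ‖∑ i ∈ s, ζ ^ κ i • c i‖ ≤ M) :
    ‖∑ i ∈ s with κ i = m, c i‖ ≤ M := by
  have hI : ∀ k : ℤ, CircleIntegrable (fun ζ : ℂ => ζ ^ k) 0 1 := fun k => by
    refine ContinuousOn.circleIntegrable zero_le_one fun ζ hζ => ?_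
    refine (continuousAt_zpow₀ ζ k (Or.inl ?_)).continuousWithinAt
    rintro rfl
    simp at hζ
  -- Integrating against ζ^(-m-1) keeps exactly the terms of frequency m.
  have key : (2 * Real.pi * Complex.I : ℂ)⁻¹ • (∮ ζ in C(0, 1), ∑ i ∈ s, ζ ^ (κ i - m - 1) • c i)
      = ∑ i ∈ s with κ i = m, c i := by
    rw [circleIntegral.integral_fun_sum, smul_sum, sum_filter]
    · refine sum_congr rfl fun i _ => ?_
      rw [circleIntegral.integral_smul_const, circleIntegral_zpow_sub_one, smul_smul]
      simp only [sub_eq_zero]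
      split_ifs
      · rw [inv_mul_cancel₀ Complex.two_pi_I_ne_zero, one_smul]
      · simp
    · intro i _
      refine ContinuousOn.circleIntegrable zero_le_one fun ζ hζ => ?_
      refine ((continuousAt_zpow₀ ζ _ (Or.inl ?_)).smul continuousAt_const).continuousWithinAt
      rintro rfl
      simp at hζ
  rw [← key]
  refine (circleIntegral.norm_two_pi_i_inv_smul_integral_le_of_norm_le_const zero_le_one
    (C := M) fun ζ hζ => ?_).trans_eq (one_mul M)
  have hζ1 : ‖ζ‖ = 1 := by simpa using hζ
  have hζ0 : ζ ≠ 0 := by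
    rintro rfl
    simp at hζ1
  have : ∑ i ∈ s, ζ ^ (κ i - m - 1) • c i = ζ ^ (-m - 1) • ∑ i ∈ s, ζ ^ κ i • c i := by
    rw [smul_sum]
    refine sum_congr rfl fun i _ => ?_
    rw [smul_smul, ← zpow_add₀ hζ0]
    congr 2
    ring
  rw [this, norm_smul, norm_zpow, hζ1, one_zpow, one_mul]
  exact hM ζ hζ1

end Averages

/-! ### Monomials and homogeneous expansions -/

section Monomials

variable {n : ℕ} {X : Type*} [NormedAddCommGroup X] [NormedSpace ℂ X]

lemma monomial_update_mul (β : Fin n → ℕ) (w : Fin n → ℂ) (i : Fin n) (ζ : ℂ) :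
    monomial β (Function.update w i (ζ * w i)) = ζ ^ β i * monomial β w := by
  unfold monomial
  rw [← mul_prod_erase univ _ (mem_univ i), ← mul_prod_erase univ (fun j => w j ^ β j) (mem_univ i),
    Function.update_self, mul_pow, mul_assoc]
  congr 2
  refine prod_congr rfl fun j hj => ?_
  rw [Function.update_of_ne (ne_of_mem_erase hj)]

/-- A coefficient of a polynomial, scaled by the monomial, is bounded by the supremum of the
polynomial on a torus. -/
lemma norm_monomial_smul_le [CompleteSpace X] (s : Finset (Fin n → ℕ)) (c : (Fin n → ℕ) → X)
    (z : Fin n → ℂ) {M : ℝ}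
    (hM : ∀ w : Fin n → ℂ, (∀ i, ‖w i‖ = ‖z i‖) → ‖∑ β ∈ s, monomial β w • c β‖ ≤ M)
    {α : Fin n → ℕ} (hα : α ∈ s) : ‖monomial α z • c α‖ ≤ M := by
  -- Exponents are fixed one coordinate at a time: rotating the i-th variable stays on the torus and
  -- isolates β i = α i.
  have key : ∀ T : Finset (Fin n), ∀ w : Fin n → ℂ, (∀ i, ‖w i‖ = ‖z i‖) →
      ‖∑ β ∈ s with ∀ i ∈ T, β i = α i, monomial β w • c β‖ ≤ M := by
    intro T
    induction T using Finset.induction_on with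
    | empty => simpa using hM
    | insert i T _ ih =>
      intro w hw
      have h := norm_sum_filter_le_of_trigPolynomial (s.filter fun β => ∀ j ∈ T, β j = α j)
        (fun β => (β i : ℤ)) (fun β => monomial β w • c β) (α i) (M := M) fun ζ hζ => by
          have h1 := ih (Function.update w i (ζ * w i)) fun j => by
            rcases eq_or_ne j i with rfl | hj
            · simp [hζ, hw]
            · simp [hj, hw]
          simpa [monomial_update_mul, mul_smul] using h1
      rw [filter_filter] at h
      convert h using 4 with β
      simp [and_comm]
  have h := key univ z fun _ => rfl
  have hs : (s.filter fun β => ∀ i ∈ univ, β i = α i) = {α} := by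
    ext β
    rw [mem_filter, mem_singleton]
    exact ⟨fun h => funext fun i => h.2 i (mem_univ i), by rintro rfl; exact ⟨hα, fun _ _ => rfl⟩⟩
  rwa [hs, sum_singleton] at h

lemma mem_multiIndices {m : ℕ} {α : Fin n → ℕ} : α ∈ multiIndices n m ↔ ∑ i, α i = m := by
  simp [multiIndices]

lemma monomial_smul (α : Fin n → ℕ) (ζ : ℂ) (z : Fin n → ℂ) :
    monomial α (ζ • z) = ζ ^ (∑ i, α i) * monomial α z := by
  simp [monomial, mul_pow, prod_mul_distrib, prod_pow_eq_pow_sum]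

/-- The multinomial theorem at (1,…,1) writes n^m as a sum of multinomial coefficients, each at
least 1. -/
lemma card_multiIndices_le (n m : ℕ) : #(multiIndices n m) ≤ n ^ m := by
  have h := sum_pow_eq_sum_piAntidiag (univ : Finset (Fin n)) (fun _ => (1 : ℕ)) m
  simp only [sum_const, card_univ, Fintype.card_fin, smul_eq_mul, mul_one, one_pow,
    prod_const_one, Nat.cast_id] at h
  rw [h, card_eq_sum_ones]
  exact sum_le_sum fun α _ => Nat.multinomial_pos _ _

lemma multiIndices_zero (n : ℕ) : multiIndices n 0 = {0} := by
  ext α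
  simp [mem_multiIndices, funext_iff]

/-- The homogeneous part of degree `m` of the power series with coefficients `c`. -/
def homogeneousPart (c : (Fin n → ℕ) → X) (m : ℕ) (z : Fin n → ℂ) : X :=
  ∑ α ∈ multiIndices n m, monomial α z • c α

lemma homogeneousPart_smul (c : (Fin n → ℕ) → X) (m : ℕ) (ζ : ℂ) (z : Fin n → ℂ) :
    homogeneousPart c m (ζ • z) = ζ ^ m • homogeneousPart c m z := by
  unfold homogeneousPart
  rw [smul_sum]
  refine sum_congr rfl fun α hα => ?_
  rw [monomial_smul, mem_multiIndices.1 hα, mul_smul]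

lemma homogeneousPart_zero (c : (Fin n → ℕ) → X) (z : Fin n → ℂ) :
    homogeneousPart c 0 z = c 0 := by
  simp [homogeneousPart, multiIndices_zero, monomial]

lemma exists_one_lt_smul_mem {Ω : Set (Fin n → ℂ)} (hΩ : IsOpen Ω) {z : Fin n → ℂ} (hz : z ∈ Ω) :
    ∃ t : ℝ, 1 < t ∧ ((t : ℂ) • z) ∈ Ω := by
  have hc : Continuous fun t : ℝ => (t : ℂ) • z := by fun_prop
  have h1 : ∀ᶠ t : ℝ in 𝓝[>] (1 : ℝ), ((t : ℂ) • z) ∈ Ω :=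
    nhdsWithin_le_nhds
      (hc.continuousAt.eventually_mem (hΩ.mem_nhds (by simpa using hz) : Ω ∈ 𝓝 (((1 : ℝ) : ℂ) • z)))
  obtain ⟨t, ht, ht'⟩ := (h1.and self_mem_nhdsWithin).exists
  exact ⟨t, ht', ht⟩

/-- Since Ω is open, the series also converges at tz for some t > 1. Its terms are bounded there, so
at z they decay like t^(-m). -/
lemma HasHolomorphicExpansionOn.summable_norm {Ω : Set (Fin n → ℂ)} (hΩ : IsOpen Ω)
    {h : (Fin n → ℂ) → X} {c : (Fin n → ℕ) → X} (hc : HasHolomorphicExpansionOn h c Ω)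
    {z : Fin n → ℂ} (hz : z ∈ Ω) : Summable fun m => ‖homogeneousPart c m z‖ := by
  obtain ⟨t, ht, htz⟩ := exists_one_lt_smul_mem hΩ hz
  have ht0 : 0 < t := by linarith
  have hs : Summable fun m => homogeneousPart c m ((t : ℂ) • z) := (hc.2 _ htz).summable
  obtain ⟨C, hC⟩ := hs.tendsto_atTop_zero.norm.bddAbove_range
  have hC' : ∀ m, ‖homogeneousPart c m ((t : ℂ) • z)‖ ≤ C := fun m => hC ⟨m, rfl⟩
  refine Summable.of_nonneg_of_le (fun _ => norm_nonneg _) (fun m => ?_)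
    ((summable_geometric_of_lt_one (inv_nonneg.2 ht0.le) (inv_lt_one_of_one_lt₀ ht)).mul_right C)
  have h1 := hC' m
  rw [homogeneousPart_smul, norm_smul, norm_pow, Complex.norm_real, Real.norm_of_nonneg ht0.le] at h1
  rw [inv_pow, inv_mul_eq_div, le_div_iff₀ (by positivity), mul_comm]
  exact h1

lemma IsCompleteReinhardtDomain.smul_mem {Ω : Set (Fin n → ℂ)} (hΩ : IsCompleteReinhardtDomain Ω)
    {z : Fin n → ℂ} (hz : z ∈ Ω) {ζ : ℂ} (hζ : ‖ζ‖ ≤ 1) : ζ • z ∈ Ω :=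
  hΩ.complete z hz _ fun i => by
    simpa using mul_le_of_le_one_left (norm_nonneg (z i)) hζ

lemma IsCompleteReinhardtDomain.zero_mem {Ω : Set (Fin n → ℂ)}
    (hΩ : IsCompleteReinhardtDomain Ω) : (0 : Fin n → ℂ) ∈ Ω := by
  obtain ⟨z, hz⟩ := hΩ.isConnected.nonempty
  simpa using hΩ.smul_mem hz (ζ := 0) (by simp)

/-- Rotation by ζ leaves the norms of the homogeneous parts unchanged, so the tail bound is uniform
on the circle. -/
lemma HasHolomorphicExpansionOn.norm_sub_partial_sum_le [CompleteSpace X] {Ω : Set (Fin n → ℂ)}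
    (hΩ : IsCompleteReinhardtDomain Ω) {h : (Fin n → ℂ) → X} {c : (Fin n → ℕ) → X}
    (hc : HasHolomorphicExpansionOn h c Ω) {z : Fin n → ℂ} (hz : z ∈ Ω) (N : ℕ) {ζ : ℂ}
    (hζ : ‖ζ‖ = 1) :
    ‖h (ζ • z) - ∑ j ∈ range N, ζ ^ j • homogeneousPart c j z‖
      ≤ ∑' j, ‖homogeneousPart c (j + N) z‖ := by
  have hs : Summable fun j => ‖homogeneousPart c j z‖ := hc.summable_norm hΩ.isOpen hz
  have h1 : HasSum (fun j => ζ ^ j • homogeneousPart c j z) (h (ζ • z)) := by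
    simp only [← homogeneousPart_smul]
    exact hc.2 _ (hΩ.smul_mem hz hζ.le)
  rw [← h1.tsum_eq, ← h1.summable.sum_add_tsum_nat_add N, add_sub_cancel_left]
  have hn : (fun j => ‖ζ ^ (j + N) • homogeneousPart c (j + N) z‖)
      = fun j => ‖homogeneousPart c (j + N) z‖ :=
    funext fun j => by rw [norm_smul, norm_pow, hζ, one_pow, one_mul]
  have hs' : Summable fun j => ‖ζ ^ (j + N) • homogeneousPart c (j + N) z‖ := by
    rw [hn]
    exact (summable_nat_add_iff (f := fun j => ‖homogeneousPart c j z‖) N).2 hs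
  exact (norm_tsum_le_tsum_norm hs').trans_eq (by rw [hn])

end Monomials

/-! ### Cauchy estimates for pluriharmonic expansions -/

section Coefficients

variable {n : ℕ} {H : Type*} [NormedAddCommGroup H] [InnerProductSpace ℂ H] [CompleteSpace H]
  {Ω : Set (Fin n → ℂ)} {f : (Fin n → ℂ) → (H →L[ℂ] H)} {a b : (Fin n → ℕ) → (H →L[ℂ] H)}

/-- The homogeneous parts of a bounded pluriharmonic function obey the Cauchy estimates. -/
lemma HasPluriharmonicExpansionOn.norm_homogeneousPart_le (hΩ : IsCompleteReinhardtDomain Ω)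
    (hf : HasPluriharmonicExpansionOn f a b Ω) {M : ℝ} (hM : ∀ z ∈ Ω, ‖f z‖ ≤ M)
    {z : Fin n → ℂ} (hz : z ∈ Ω) (m : ℕ) :
    ‖homogeneousPart a m z‖ ≤ M ∧ ‖homogeneousPart b m z‖ ≤ M := by
  obtain ⟨hb0, h, g, hh, hg, hfhg⟩ := hf
  set A := fun j => homogeneousPart a j z with hA
  set B := fun j => homogeneousPart b j z with hB
  have hB0 : B 0 = 0 := by rw [hB]; simp [homogeneousPart_zero, hb0]
  set ε : ℕ → ℝ := fun N => (∑' j, ‖A (j + N)‖) + ∑' j, ‖B (j + N)‖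
  have hε0 : Tendsto ε atTop (𝓝 0) := by
    simpa using (tendsto_sum_nat_add fun j => ‖A j‖).add (tendsto_sum_nat_add fun j => ‖B j‖)
  -- Truncating both series at N gives a trigonometric polynomial in ζ, with the adjoint part at
  -- frequencies -j, within ε N of f on the circle.
  have trig : ∀ N : ℕ, ∀ ζ : ℂ, ‖ζ‖ = 1 →
      ‖∑ i ∈ (range N).disjSum (range N), ζ ^ (Sum.elim (fun j : ℕ => (j : ℤ))
        (fun j : ℕ => -(j : ℤ)) i) • Sum.elim A (fun j => ContinuousLinearMap.adjoint (B j)) i‖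
        ≤ M + ε N := by
    intro N ζ hζ
    have hmem := hΩ.smul_mem hz hζ.le
    have hconj : (starRingEnd ℂ) ζ = ζ⁻¹ := (Complex.inv_eq_conj hζ).symm
    have e1 : ContinuousLinearMap.adjoint (∑ j ∈ range N, ζ ^ j • B j)
        = ∑ j ∈ range N, ζ ^ (-(j : ℤ)) • ContinuousLinearMap.adjoint (B j) := by
      rw [map_sum]
      refine sum_congr rfl fun j _ => ?_
      rw [map_smulₛₗ, map_pow, hconj, zpow_neg, zpow_natCast, inv_pow]
    rw [sum_disjSum]
    simp only [Sum.elim_inl, Sum.elim_inr, zpow_natCast, ← e1]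
    have e2 : ∑ j ∈ range N, ζ ^ j • A j
        + ContinuousLinearMap.adjoint (∑ j ∈ range N, ζ ^ j • B j)
        = f (ζ • z) - ((h (ζ • z) - ∑ j ∈ range N, ζ ^ j • A j)
          + ContinuousLinearMap.adjoint (g (ζ • z) - ∑ j ∈ range N, ζ ^ j • B j)) := by
      rw [hfhg _ hmem, map_sub]
      abel
    rw [e2]
    refine (norm_sub_le _ _).trans (add_le_add (hM _ hmem) ((norm_add_le _ _).trans ?_))
    rw [LinearIsometryEquiv.norm_map]
    exact add_le_add (hh.norm_sub_partial_sum_le hΩ hz N hζ) (hg.norm_sub_partial_sum_le hΩ hz N hζ)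
  have lim : Tendsto (fun N => M + ε N) atTop (𝓝 M) := by simpa using hε0.const_add M
  constructor
  · refine ge_of_tendsto lim ?_
    filter_upwards [eventually_gt_atTop m] with N hN
    have h1 := norm_sum_filter_le_of_trigPolynomial _ _ _ (m : ℤ) (trig N)
    rw [sum_filter, sum_disjSum] at h1
    simp only [Sum.elim_inl, Sum.elim_inr, Nat.cast_inj, sum_ite_eq', mem_range, hN, if_true] at h1
    rw [sum_eq_zero, add_zero] at h1
    · exact h1
    · intro j _
      -- The two families of frequencies meet only at 0, where the adjoint part vanishes because b 0
      -- = 0.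
      by_cases hj : -(j : ℤ) = m
      · refine (if_pos hj).trans ?_
        rw [show j = 0 by omega, hB0, map_zero]
      · exact if_neg hj
  · rcases Nat.eq_zero_or_pos m with rfl | hm
    · change ‖B 0‖ ≤ M
      rw [hB0, norm_zero]
      exact (norm_nonneg _).trans (hM z hz)
    · refine ge_of_tendsto lim ?_
      filter_upwards [eventually_gt_atTop m] with N hN
      have h1 := norm_sum_filter_le_of_trigPolynomial _ _ _ (-m : ℤ) (trig N)
      rw [sum_filter, sum_disjSum] at h1
      simp only [Sum.elim_inl, Sum.elim_inr, neg_inj, Nat.cast_inj, sum_ite_eq', mem_range, hN,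
        if_true] at h1
      rw [sum_eq_zero, zero_add, LinearIsometryEquiv.norm_map] at h1
      · exact h1
      · intro j _
        exact if_neg (show ¬(j : ℤ) = -m by omega)

/-- The Cauchy estimates for the coefficients of a bounded pluriharmonic function. -/
lemma HasPluriharmonicExpansionOn.norm_monomial_mul_norm_le (hΩ : IsCompleteReinhardtDomain Ω)
    (hf : HasPluriharmonicExpansionOn f a b Ω) {M : ℝ} (hM : ∀ z ∈ Ω, ‖f z‖ ≤ M)
    {z : Fin n → ℂ} (hz : z ∈ Ω) (α : Fin n → ℕ) :
    ‖monomial α z‖ * ‖a α‖ ≤ M ∧ ‖monomial α z‖ * ‖b α‖ ≤ M := by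
  have hα : α ∈ multiIndices n (∑ i, α i) := mem_multiIndices.2 rfl
  have hw : ∀ w : Fin n → ℂ, (∀ i, ‖w i‖ = ‖z i‖) → w ∈ Ω := fun w hw =>
    hΩ.complete z hz w fun i => (hw i).le
  simp only [← norm_smul]
  exact ⟨norm_monomial_smul_le _ a z
      (fun w h => (hf.norm_homogeneousPart_le hΩ hM (hw w h) _).1) hα,
    norm_monomial_smul_le _ b z
      (fun w h => (hf.norm_homogeneousPart_le hΩ hM (hw w h) _).2) hα⟩

end Coefficients

/-! ### The product of the two inclusion scales -/

section InclusionScale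

variable {n : ℕ} {Ω : Set (Fin n → ℂ)}

/-- The supremum R of one coordinate's modulus over Ω is finite and positive, and the inclusion
forces R ≤ tR. -/
lemma one_le_of_subset_smul (hn : 1 ≤ n) (hΩ : IsOpen Ω) (hne : Ω.Nonempty)
    (hb : Bornology.IsBounded Ω) {t : ℝ} (ht : 0 < t) (h : Ω ⊆ t • Ω) : 1 ≤ t := by
  let i : Fin n := ⟨0, hn⟩
  obtain ⟨C, hC⟩ := hb.exists_norm_le
  have hbdd : BddAbove ((fun z : Fin n → ℂ => ‖z i‖) '' Ω) :=
    ⟨C, by rintro _ ⟨z, hz, rfl⟩; exact (norm_le_pi_norm z i).trans (hC z hz)⟩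
  set R := sSup ((fun z : Fin n → ℂ => ‖z i‖) '' Ω)
  have hle : ∀ z ∈ Ω, ‖z i‖ ≤ R := fun z hz => le_csSup hbdd ⟨z, hz, rfl⟩
  have hRt : R ≤ t * R := by
    refine csSup_le (hne.image _) ?_
    rintro _ ⟨z, hz, rfl⟩
    obtain ⟨w, hw, rfl⟩ := h hz
    simpa [abs_of_pos ht] using mul_le_mul_of_nonneg_left (hle w hw) ht.le
  have hR0 : 0 < R := by
    obtain ⟨z, hz⟩ := hne
    obtain ⟨ε, hε, hball⟩ := Metric.isOpen_iff.1 hΩ z hz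
    by_contra hneg
    have hz0 : z i = 0 := norm_le_zero_iff.1 ((hle z hz).trans (not_lt.1 hneg))
    have hmem : z + Pi.single i ((ε / 2 : ℝ) : ℂ) ∈ Ω := hball (by
      rw [Metric.mem_ball, dist_eq_norm, add_sub_cancel_left, Pi.norm_single, Complex.norm_real,
        Real.norm_of_nonneg (by positivity)]
      linarith)
    have h1 := hle _ hmem
    rw [Pi.add_apply, hz0, zero_add, Pi.single_eq_same, Complex.norm_real,
      Real.norm_of_nonneg (by positivity)] at h1
    linarith
  by_contra hlt
  nlinarith

lemma one_div_inclusionScale_mul_le_one (hn : 1 ≤ n) (hΩ : IsOpen Ω) (hne : Ω.Nonempty)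
    (hb : Bornology.IsBounded Ω) (E : Set (Fin n → ℂ)) :
    1 / (inclusionScale Ω E * inclusionScale E Ω) ≤ 1 := by
  -- With no admissible scale the infimum is 0 by convention, and so is the quotient.
  rcases Set.eq_empty_or_nonempty {s : ℝ | 0 < s ∧ Ω ⊆ s • E} with h1 | h1
  · simp [inclusionScale, h1]
  rcases Set.eq_empty_or_nonempty {s : ℝ | 0 < s ∧ E ⊆ s • Ω} with h2 | h2
  · simp [inclusionScale, h2]
  have hst : ∀ s ∈ {s : ℝ | 0 < s ∧ Ω ⊆ s • E}, ∀ t ∈ {s : ℝ | 0 < s ∧ E ⊆ s • Ω},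
      1 ≤ s * t := by
    rintro s ⟨hs, hsE⟩ t ⟨ht, htΩ⟩
    refine one_le_of_subset_smul hn hΩ hne hb (mul_pos hs ht) ?_
    rw [mul_smul]
    exact hsE.trans (Set.smul_set_mono htΩ)
  have hS2 : ∀ s ∈ {s : ℝ | 0 < s ∧ Ω ⊆ s • E}, 1 / s ≤ inclusionScale E Ω := fun s hs =>
    le_csInf h2 fun t ht => (div_le_iff₀' hs.1).2 (hst s hs t ht)
  have hpos : 0 < inclusionScale E Ω := by
    obtain ⟨s, hs⟩ := h1
    exact (one_div_pos.2 hs.1).trans_le (hS2 s hs)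
  have hS1 : 1 / inclusionScale E Ω ≤ inclusionScale Ω E :=
    le_csInf h1 fun s hs => (div_le_comm₀ hs.1 hpos).1 (hS2 s hs)
  have h12 : 1 ≤ inclusionScale Ω E * inclusionScale E Ω := (div_le_iff₀ hpos).1 hS1
  exact (div_le_one (by linarith)).2 h12

end InclusionScale

/-! ### The explicit constant lies below the threshold -/

section Constant

variable {lam p u : ℝ}

/-- With L = lam^p and t = u^p, all candidates carry the factor L - t, so only denominators are
compared; K^p L ≤ 1/8 gives K^p (L+t) ≤ 1/4. -/
lemma boundConst_pos_and_rpow_le (hp : 1 ≤ p) (hlam : 1 < lam) (hu : 0 < u) (hul : u < lam) :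
    0 < boundConst lam p u ∧
      boundConst lam p u ^ p ≤ (lam ^ p - u ^ p) / (lam ^ p + u ^ p) := by
  have hp0 : 0 < p := by linarith
  set L := lam ^ p with hL
  set t := u ^ p with ht
  set K := 1 / (4 * lam * 2 ^ (1 / p)) with hK
  have hK0 : 0 < K := by positivity
  have ht0 : 0 < t := Real.rpow_pos_of_pos hu p
  have htL : t < L := Real.rpow_lt_rpow hu.le hul hp0
  have hlL : lam ≤ L := Real.self_le_rpow_of_one_le hlam.le hp
  have hKp : K ^ p * L ≤ 1 / 8 := by
    have h4 : (4 : ℝ) ≤ 4 ^ p := Real.self_le_rpow_of_one_le (by norm_num) hp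
    have hL0 : 0 < L := by linarith
    rw [hK, Real.div_rpow zero_le_one (by positivity), Real.mul_rpow (by positivity) (by positivity),
      Real.mul_rpow (by positivity) (by positivity), ← Real.rpow_mul (by norm_num),
      one_div_mul_cancel hp0.ne', Real.rpow_one, Real.one_rpow, ← hL, div_mul_eq_mul_div, one_mul,
      div_le_div_iff₀ (by positivity) (by positivity)]
    nlinarith
  have hk0 : 0 < K ^ p := Real.rpow_pos_of_pos hK0 p
  have hkt : K ^ p * t ≤ 1 / 8 := (mul_le_mul_of_nonneg_left htL.le hk0.le).trans hKp
  have pow_mul : ∀ A : ℝ, 0 ≤ A → (K * A ^ (1 / p)) ^ p = K ^ p * A := fun A hA => by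
    rw [Real.mul_rpow hK0.le (by positivity), ← Real.rpow_mul hA, one_div_mul_cancel hp0.ne',
      Real.rpow_one]
  have hA1 : 0 < (L - t) / (2 * L - u) := div_pos (by linarith) (by linarith)
  have hA2 : 0 < (L - t) / (L - t + 1) := div_pos (by linarith) (by linarith)
  have b1 : 0 < K * ((L - t) / (2 * L - u)) ^ (1 / p) ∧
      (K * ((L - t) / (2 * L - u)) ^ (1 / p)) ^ p ≤ (L - t) / (L + t) := by
    refine ⟨by positivity, ?_⟩
    rw [pow_mul _ hA1.le, ← mul_div_assoc, div_le_div_iff₀ (by linarith) (by linarith)]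
    nlinarith
  have max_rpow : ∀ x y B : ℝ, (0 < x ∧ x ^ p ≤ B) → (0 < y ∧ y ^ p ≤ B) →
      0 < max x y ∧ (max x y) ^ p ≤ B := fun x y B hx hy => by
    rcases max_choice x y with h | h <;> rw [h] <;> assumption
  unfold boundConst
  rw [← hK, ← hL, ← ht]
  split_ifs with h
  · refine max_rpow _ _ _ b1 ⟨by positivity, ?_⟩
    have hkt' : K ^ p ≤ t := Real.rpow_le_rpow hK0.le h hp0.le
    rw [Real.mul_rpow (by positivity) (by positivity), pow_mul _ hA2.le,
      Real.div_rpow zero_le_one hu.le, Real.one_rpow, ← ht, mul_one_div, ← mul_div_assoc, div_div,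
      div_le_div_iff₀ (by positivity) (by linarith)]
    have hk1 : K ^ p ≤ 1 / 8 := (le_mul_of_one_le_right hk0.le (by linarith)).trans hKp
    -- Split L + t = (L - t) + 2t, using K^p ≤ t on the first part and K^p ≤ 1/8 on the second.
    have h1 : K ^ p * (L + t) ≤ (L - t + 1) * t := by
      nlinarith [mul_le_mul_of_nonneg_right hkt' (sub_pos.2 htL).le,
        mul_le_mul_of_nonneg_right hk1 ht0.le]
    nlinarith
  · refine max_rpow _ _ _ b1 ⟨by positivity, ?_⟩
    rw [pow_mul _ hA2.le, ← mul_div_assoc, div_le_div_iff₀ (by linarith) (by linarith)]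
    nlinarith

end Constant

/-! ### Estimate of the Bohr sum -/

section BohrSum

variable {n : ℕ} {H : Type*} [NormedAddCommGroup H] [InnerProductSpace ℂ H] [CompleteSpace H]
  {Y : Type*} [NormedAddCommGroup Y] [NormedSpace ℂ Y]
  {Ω : Set (Fin n → ℂ)} {f : (Fin n → ℂ) → (H →L[ℂ] H)} {a b : (Fin n → ℕ) → (H →L[ℂ] H)}

lemma rpow_opNorm_mul_le {X Z : Type*} [NormedAddCommGroup X] [NormedSpace ℂ X]
    [NormedAddCommGroup Z] [NormedSpace ℂ Z] (U : X →L[ℂ] Z) {x : X} {s M p : ℝ} (hs : 0 ≤ s)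
    (hp : 0 ≤ p) (h : s * ‖x‖ ≤ M) : ‖U x‖ ^ p * s ^ p ≤ ‖U‖ ^ p * M ^ p := by
  rw [← Real.mul_rpow (norm_nonneg _) hs,
    ← Real.mul_rpow (norm_nonneg _) ((mul_nonneg hs (norm_nonneg _)).trans h)]
  refine Real.rpow_le_rpow (by positivity) ?_ hp
  calc ‖U x‖ * s ≤ ‖U‖ * ‖x‖ * s := mul_le_mul_of_nonneg_right (U.le_opNorm x) hs
    _ = ‖U‖ * (s * ‖x‖) := by ring
    _ ≤ ‖U‖ * M := mul_le_mul_of_nonneg_left h (norm_nonneg _)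

lemma bohrSum_le (hΩ : IsCompleteReinhardtDomain Ω) (hf : HasPluriharmonicExpansionOn f a b Ω)
    {M : ℝ} (hM : ∀ z ∈ Ω, ‖f z‖ ≤ M) (U : (H →L[ℂ] H) →L[ℂ] Y) {p r : ℝ} (hp : 0 < p)
    (hr : 0 ≤ r) (hx : n * r ^ p < 1) :
    bohrSum Ω p U a b r ≤ ENNReal.ofReal
      (‖U‖ ^ p * M ^ p + 2 * (‖U‖ ^ p * M ^ p) * (n * r ^ p / (1 - n * r ^ p))) := by
  set x := n * r ^ p with hxdef
  have hM0 : 0 ≤ M := (norm_nonneg _).trans (hM 0 hΩ.zero_mem)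
  set T := ‖U‖ ^ p * M ^ p with hT
  have hT0 : 0 ≤ T := by positivity
  have hrp : 0 ≤ r ^ p := by positivity
  have hx0 : 0 ≤ x := by positivity
  have term : ∀ m : ℕ, ∀ α ∈ multiIndices n m, (⨆ z ∈ r • Ω,
      ENNReal.ofReal ((‖U (a α)‖ ^ p + ‖U (b α)‖ ^ p) * ‖monomial α z‖ ^ p))
        ≤ ENNReal.ofReal (2 * T * (r ^ p) ^ m) := by
    intro m α hα
    refine iSup₂_le fun z hz => ENNReal.ofReal_le_ofReal ?_
    obtain ⟨w, hw, rfl⟩ := hz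
    obtain ⟨ha, hb⟩ := hf.norm_monomial_mul_norm_le hΩ hM hw α
    have h1 := rpow_opNorm_mul_le U (norm_nonneg _) hp.le ha
    have h2 := rpow_opNorm_mul_le U (norm_nonneg _) hp.le hb
    have hmon : ‖monomial α (r • w)‖ ^ p = (r ^ p) ^ m * ‖monomial α w‖ ^ p := by
      have : r • w = (r : ℂ) • w := by
        ext i
        simp
      rw [this, monomial_smul, mem_multiIndices.1 hα, norm_mul, norm_pow, Complex.norm_real,
        Real.norm_of_nonneg hr, Real.mul_rpow (by positivity) (norm_nonneg _),
        Real.rpow_pow_comm hr]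
    simp only [hmon]
    calc (‖U (a α)‖ ^ p + ‖U (b α)‖ ^ p) * ((r ^ p) ^ m * ‖monomial α w‖ ^ p)
        = (‖U (a α)‖ ^ p * ‖monomial α w‖ ^ p + ‖U (b α)‖ ^ p * ‖monomial α w‖ ^ p)
          * (r ^ p) ^ m := by ring
      _ ≤ 2 * T * (r ^ p) ^ m := mul_le_mul_of_nonneg_right (by linarith) (by positivity)
  -- The bound is T rather than 2T because b 0 = 0; the threshold depends on this saving.
  have term0 : (∑ α ∈ multiIndices n 0, ⨆ z ∈ r • Ω,
      ENNReal.ofReal ((‖U (a α)‖ ^ p + ‖U (b α)‖ ^ p) * ‖monomial α z‖ ^ p))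
        ≤ ENNReal.ofReal T := by
    rw [multiIndices_zero, sum_singleton]
    refine iSup₂_le fun z _ => ENNReal.ofReal_le_ofReal ?_
    have h1 := rpow_opNorm_mul_le U (norm_nonneg _) hp.le
      (hf.norm_monomial_mul_norm_le hΩ hM hΩ.zero_mem 0).1
    rw [hf.1, map_zero, norm_zero, Real.zero_rpow hp.ne', add_zero]
    simpa [monomial] using h1
  have degree : ∀ m : ℕ, (∑ α ∈ multiIndices n m, ⨆ z ∈ r • Ω,
      ENNReal.ofReal ((‖U (a α)‖ ^ p + ‖U (b α)‖ ^ p) * ‖monomial α z‖ ^ p))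
        ≤ ENNReal.ofReal (2 * T * x ^ m) := by
    intro m
    refine (sum_le_card_nsmul _ _ _ (term m)).trans ?_
    rw [← ENNReal.ofReal_nsmul]
    refine ENNReal.ofReal_le_ofReal ?_
    rw [nsmul_eq_mul, hxdef, mul_pow]
    calc (#(multiIndices n m) : ℝ) * (2 * T * (r ^ p) ^ m)
        ≤ (n : ℝ) ^ m * (2 * T * (r ^ p) ^ m) :=
          mul_le_mul_of_nonneg_right (by exact_mod_cast card_multiIndices_le n m) (by positivity)
      _ = 2 * T * (n ^ m * (r ^ p) ^ m) := by ring
  have geom : HasSum (fun m : ℕ => 2 * T * x ^ (m + 1)) (2 * T * (x / (1 - x))) := by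
    have := ((hasSum_geometric_of_lt_one hx0 hx).mul_left x).mul_left (2 * T)
    simpa only [pow_succ', div_eq_mul_inv] using this
  unfold bohrSum
  rw [tsum_eq_zero_add' ENNReal.summable, ENNReal.ofReal_add hT0
    (mul_nonneg (by positivity) (div_nonneg hx0 (by linarith)))]
  refine add_le_add term0 ?_
  rw [← geom.tsum_eq, ENNReal.ofReal_tsum_of_nonneg (fun m => by positivity) geom.summable]
  exact ENNReal.tsum_le_tsum fun m => degree (m + 1)

lemma norm_le_supNorm (hf : IsBoundedPluriharmonicOn f Ω) {z : Fin n → ℂ} (hz : z ∈ Ω) :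
    ‖f z‖ ≤ supNorm f Ω := by
  obtain ⟨C, hC⟩ := hf.2
  exact le_ciSup (f := fun z : Ω => ‖f z‖) ⟨C, by rintro _ ⟨w, rfl⟩; exact hC w w.2⟩ ⟨z, hz⟩

/-- Every radius `r` with `n r^p ≤ (lam^p - ‖U‖^p) / (lam^p + ‖U‖^p)` is a Bohr radius. -/
lemma le_secondBohrRadius (hΩ : IsCompleteReinhardtDomain Ω) {lam p r : ℝ} (hp : 0 < p)
    (U : (H →L[ℂ] H) →L[ℂ] Y) (hU : U ≠ 0) (hUlam : ‖U‖ < lam) (hr : r ∈ Set.Icc (0 : ℝ) 1)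
    (hx : n * r ^ p ≤ (lam ^ p - ‖U‖ ^ p) / (lam ^ p + ‖U‖ ^ p)) :
    r ≤ secondBohrRadius lam Ω p U := by
  refine le_csSup ⟨1, fun s hs => hs.1.2⟩ ⟨hr, fun f hf a b hab => ?_⟩
  have hu : 0 < ‖U‖ := norm_pos_iff.2 hU
  have ht0 : 0 < ‖U‖ ^ p := Real.rpow_pos_of_pos hu p
  have htL : ‖U‖ ^ p < lam ^ p := Real.rpow_lt_rpow hu.le hUlam hp
  have hx' := (le_div_iff₀ (by linarith)).1 hx
  have hx1 : n * r ^ p < 1 := by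
    refine hx.trans_lt ((div_lt_one (by linarith)).2 (by linarith))
  refine (bohrSum_le hΩ hab (fun z hz => norm_le_supNorm hf hz) U hp hr.1 hx1).trans
    (ENNReal.ofReal_le_ofReal ?_)
  have hS : 0 ≤ supNorm f Ω := (norm_nonneg _).trans (norm_le_supNorm hf hΩ.zero_mem)
  have key : 2 * ‖U‖ ^ p * (n * r ^ p / (1 - n * r ^ p)) ≤ lam ^ p - ‖U‖ ^ p := by
    rw [← mul_div_assoc, div_le_iff₀ (by linarith)]
    linarith
  calc ‖U‖ ^ p * supNorm f Ω ^ p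
        + 2 * (‖U‖ ^ p * supNorm f Ω ^ p) * (n * r ^ p / (1 - n * r ^ p))
      = (‖U‖ ^ p + 2 * ‖U‖ ^ p * (n * r ^ p / (1 - n * r ^ p))) * supNorm f Ω ^ p := by ring
    _ ≤ lam ^ p * supNorm f Ω ^ p :=
      mul_le_mul_of_nonneg_right (by linarith) (by positivity)

end BohrSum

end SecondBohr

/-! ### The main theorem -/

theorem theorem1p1 {H : Type*} [NormedAddCommGroup H] [InnerProductSpace ℂ H] [CompleteSpace H]
    {Y : Type*} [NormedAddCommGroup Y] [NormedSpace ℂ Y] [CompleteSpace Y]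
    (n : ℕ) (hn : 1 ≤ n) (Ω : Set (Fin n → ℂ))
    (hΩ : SecondBohr.IsCompleteReinhardtDomain Ω) (hΩb : Bornology.IsBounded Ω)
    (hΩs : IsSimplyConnected Ω)
    (p lam : ℝ) (hp : 1 ≤ p) (hlam : 1 < lam)
    (U : (H →L[ℂ] H) →L[ℂ] Y) (hU : U ≠ 0) (hUlam : ‖U‖ < lam) :
    SecondBohr.boundConst lam p ‖U‖ * (1 / (n : ℝ) ^ (1 / p)) *
        (1 / (SecondBohr.inclusionScale Ω (SecondBohr.polydisc n) *
          SecondBohr.inclusionScale (SecondBohr.polydisc n) Ω))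
      ≤ SecondBohr.secondBohrRadius lam Ω p U ∧
    0 < SecondBohr.secondBohrRadius lam Ω p U := by
  have hp0 : 0 < p := by linarith
  have hu : 0 < ‖U‖ := norm_pos_iff.2 hU
  have hn0 : (0 : ℝ) < n := by exact_mod_cast hn
  have hn1 : (1 : ℝ) ≤ n := by exact_mod_cast hn
  obtain ⟨hD0, hD⟩ := SecondBohr.boundConst_pos_and_rpow_le hp hlam hu hUlam
  set D := SecondBohr.boundConst lam p ‖U‖
  have ht0 : 0 < ‖U‖ ^ p := Real.rpow_pos_of_pos hu p
  have htL : ‖U‖ ^ p < lam ^ p := Real.rpow_lt_rpow hu.le hUlam hp0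
  have hD1 : D ≤ 1 := by
    by_contra h
    have h1 := Real.one_lt_rpow (not_le.1 h) hp0
    exact absurd (h1.trans_le hD) (not_lt.2 ((div_le_one (by linarith)).2 (by linarith)))
  have hnp : 1 ≤ (n : ℝ) ^ (1 / p) := Real.one_le_rpow hn1 (by positivity)
  have hr0 : 0 < D * (1 / (n : ℝ) ^ (1 / p)) := by positivity
  have hr1 : D * (1 / (n : ℝ) ^ (1 / p)) ≤ 1 :=
    mul_le_one₀ hD1 (by positivity) ((div_le_one (by linarith)).2 hnp)
  -- The factor n^(-1/p) cancels the count of multi-indices exactly.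
  have hrp : n * (D * (1 / (n : ℝ) ^ (1 / p))) ^ p = D ^ p := by
    rw [Real.mul_rpow hD0.le (by positivity), Real.div_rpow zero_le_one (by positivity),
      Real.one_rpow, ← Real.rpow_mul hn0.le, one_div_mul_cancel hp0.ne', Real.rpow_one]
    field_simp
  have hle := SecondBohr.le_secondBohrRadius hΩ hp0 U hU hUlam ⟨hr0.le, hr1⟩ (hrp.trans_le hD)
  exact ⟨(mul_le_of_le_one_right hr0.le (SecondBohr.one_div_inclusionScale_mul_le_one hn hΩ.isOpen
    hΩ.isConnected.nonempty hΩb _)).trans hle, hr0.trans_le hle⟩
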